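/- Secure caching model. A server has $N$ independent files $W_1,\dots,W_N$, each uniform on $\{1,\dots,2^F\}$, and serves $K$ users over a shared link that an external wiretapper observes. An $(M,R)$ secure caching scheme for file size $F$ consists of random caching functions $Z_k=\phi_k(W_1,\dots,W_N)$, $k\in[K]$, each taking at most $2^{MF}$ values, random encoding functions $X_d=\psi_d(W_1,\dots,W_N)$, $d\in[N]^K$, each taking at most $2^{RF}$ values (the randomness is common to all the caching and encoding functions, so that it can serve as secret keys, and is independent of the files), and decoding functions $\hat W_{d,k}=\mu_{d,k}(X_d,Z_k)$. Let $P_e=\max_{d,k}\mathbb P(\hat W_{d,k}\ne W_{d_k})$ and $L=\max_d I(X_d;W_1,\dots,W_N)$. The pair $(M,R)$ is securely achievable if for every $\epsilon>0$ and every large enough $F$ there is an $(M,R)$ secure caching scheme with $P_e\le\epsilon$ and $L\le\epsilon$; and $R^*_s(M)=\inf\{R:(M,R)\text{ is securely achievable}\}$. The centralized secure rate $R^C_s(M)$, $1\le M\le N$, is the lower convex envelope of the $K+1$ points $$\left(M_t,\ \frac{K\left(1-\frac{M_t-1}{N-1}\right)}{1+K\,\frac{M_t-1}{N-1}}\right),\qquad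 M_t=\frac{N-1}{K}\,t+1,\quad t=0,1,\dots,K.$$ Theorem. Let $N\ge 2$ and $K\ge 1$, and let $M$ be a real number with $$\max\left\{\frac{(K-N)(N-1)}{KN}+1,\ 1\right\}\le M\le N.$$ Then some rate is securely achievable at $M$. If $M<N$, then $R^*_s(M)>0$ and $$1\le \frac{R^C_s(M)}{R^*_s(M)}\le 17;$$ if $M=N$, then $R^C_s(M)=R^*_s(M)=0$. -/

import Mathlib

open MeasureTheory

namespace SecureCaching

noncomputable section

/-- The contents of the database: `N` files, each an element of a set of size `2 ^ F`. -/
abbrev Files (N F : ℕ) : Type := Fin N → Fin (2 ^ F)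

/-- The request vectors `(d_1, …, d_K)`. -/
abbrev Demand (N K : ℕ) : Type := Fin K → Fin N

/-- The law of the database: the `N` files are independent and uniform on their `2 ^ F` values. -/
def filesLaw (N F : ℕ) : Measure (Files N F) :=
  Measure.pi fun _ : Fin N => ProbabilityTheory.uniformOn (Set.univ : Set (Fin (2 ^ F)))

/-- Mutual information, in bits, of two finitely valued random variables `X` and `Y` under the
probability measure `P`. Terms with `P(X = a, Y = b) = 0` vanish. -/
def mutualInfo {Ω α β : Type*} [MeasurableSpace Ω] [Fintype α] [Fintype β]
    (P : Measure Ω) (X : Ω → α) (Y : Ω → β) : ℝ :=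
  ∑ a : α, ∑ b : β, P.real {ω | X ω = a ∧ Y ω = b} *
    Real.logb 2 (P.real {ω | X ω = a ∧ Y ω = b} / (P.real {ω | X ω = a} * P.real {ω | Y ω = b}))

/-- A secure caching scheme with `N` files of `F` bits, `K` users, cache size `M * F` bits and
transmission size `R * F` bits. The randomness `θ` of the caching and encoding functions is drawn
at the server from an arbitrary probability space, independently of the files; being common to the
caching functions and the encoding functions, it contains the secret keys. An object of size at
most `x` bits is an object that takes at most `2 ^ x` values. -/
structure Scheme (N K F : ℕ) (M R : ℝ) where
  /-- The space of the server's randomness. -/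
  Θ : Type
  /-- Its events. -/
  mΘ : MeasurableSpace Θ
  /-- The law of the server's randomness. -/
  ν : Measure Θ
  /-- It is a probability law. -/
  prob : IsProbabilityMeasure ν
  /-- The random caching functions. -/
  cache : Fin K → Files N F → Θ → Fin ⌊(2 : ℝ) ^ (M * (F : ℝ))⌋₊
  measurable_cache : ∀ k w, Measurable (cache k w)
  /-- The random encoding functions. -/
  encode : Demand N K → Files N F → Θ → Fin ⌊(2 : ℝ) ^ (R * (F : ℝ))⌋₊
  measurable_encode : ∀ d w, Measurable (encode d w)
  /-- The decoding functions. -/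
  decode : Demand N K → Fin K → Fin ⌊(2 : ℝ) ^ (R * (F : ℝ))⌋₊ →
    Fin ⌊(2 : ℝ) ^ (M * (F : ℝ))⌋₊ → Fin (2 ^ F)

namespace Scheme

variable {N K F : ℕ} {M R : ℝ}

instance (S : Scheme N K F M R) : MeasurableSpace S.Θ := S.mΘ

instance (S : Scheme N K F M R) : IsProbabilityMeasure S.ν := S.prob

/-- The joint law of the files and of the server's randomness, which are independent. -/
def law (S : Scheme N K F M R) : Measure (Files N F × S.Θ) := (filesLaw N F).prod S.ν

/-- The cache content `Z_k` of user `k`. -/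
def Z (S : Scheme N K F M R) (k : Fin K) (ω : Files N F × S.Θ) :
    Fin ⌊(2 : ℝ) ^ (M * (F : ℝ))⌋₊ :=
  S.cache k ω.1 ω.2

/-- The transmission `X_d` over the shared link for the request vector `d`. -/
def X (S : Scheme N K F M R) (d : Demand N K) (ω : Files N F × S.Θ) :
    Fin ⌊(2 : ℝ) ^ (R * (F : ℝ))⌋₊ :=
  S.encode d ω.1 ω.2

/-- The probability that user `k` decodes its requested file wrongly, for the requests `d`. -/
def errorProb (S : Scheme N K F M R) (d : Demand N K) (k : Fin K) : ℝ :=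
  S.law.real {ω | S.decode d k (S.X d ω) (S.Z k ω) ≠ ω.1 (d k)}

/-- The information about the files that the wiretapper gets from `X_d`. -/
def leakage (S : Scheme N K F M R) (d : Demand N K) : ℝ :=
  mutualInfo S.law (S.X d) (fun ω => ω.1)

end Scheme

/-- The pair `(M, R)` is securely achievable: for every `ε > 0` and every large enough file size
`F` there is a scheme whose error probability (maximum over requests and users) and whose leakage
(maximum over requests) are at most `ε`. -/
def SecurelyAchievable (N K : ℕ) (M R : ℝ) : Prop :=
  ∀ ε : ℝ, 0 < ε → ∃ F₀ : ℕ, ∀ F : ℕ, F₀ ≤ F → ∃ S : Scheme N K F M R,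
    (∀ d k, S.errorProb d k ≤ ε) ∧ (∀ d, S.leakage d ≤ ε)

/-- The secure memory-rate tradeoff `R*_s(M)`. -/
def optimalRate (N K : ℕ) (M : ℝ) : ℝ := sInf {R : ℝ | SecurelyAchievable N K M R}

/-- The memory `M_t = (N - 1) t / K + 1` of the `t`-th corner point. -/
def cornerMemory (N K t : ℕ) : ℝ := ((N : ℝ) - 1) / K * t + 1

/-- The rate formula `K (1 - (M-1)/(N-1)) / (1 + K (M-1)/(N-1))`, used at the corner points. -/
def rateFormula (N K : ℕ) (M : ℝ) : ℝ :=
  K * (1 - (M - 1) / ((N : ℝ) - 1)) * (1 / (1 + K * ((M - 1) / ((N : ℝ) - 1))))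

/-- The corner points of the centralized scheme, for `t = 0, 1, …, K`. -/
def cornerPoints (N K : ℕ) : Set (ℝ × ℝ) :=
  Set.range fun t : Fin (K + 1) => (cornerMemory N K t, rateFormula N K (cornerMemory N K t))

/-- The centralized secure rate `R^C_s(M)`, for `1 ≤ M ≤ N`: the lower convex envelope of the
corner points. -/
def centralizedRate (N K : ℕ) (M : ℝ) : ℝ :=
  sInf {R : ℝ | (M, R) ∈ convexHull ℝ (cornerPoints N K)}

end

end SecureCaching

/-! Put x = (M - 1)/(N - 1), t = ⌊Kx⌋ and B = K/(t + 1). For M < N both rates are compared with (1 -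
x)B.

Achievability is Maddah-Ali–Niesen coded caching in which each multicast bit is masked by a key bit
cached by exactly its recipients (`exists_scheme_of_card_le`). Such schemes have zero error and zero
leakage. Splitting files among the levels t reaches every pair strictly above a hull point in both
coordinates, and a limiting argument gives R*_s ≤ R^C_s (`optimalRate_le_of_mem_convexHull`). The
chord from corner t to (N, 0) gives R^C_s ≤ (1 - x)B (`chord_mem_convexHull`).

For the converse, l users served by m + 1 transmissions recover l(m + 1) distinct files. The first
transmission is almost independent of the files, so the other m and the l caches must carry them:
l(m + 1) ≤ mR + lM (`SecurelyAchievable.cutset_bound`). Taking l near B/7 and l(m + 1) near N yields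
R ≥ (1 - x)B/17. The K-dependent lower bound on M serves to ensure B ≤ 2N, so that N files suffice
for this choice. -/

namespace SecureCaching

/-! ### Mutual information bounded below by a single event -/

/-- An event likely under p and unlikely under q forces a large relative entropy. The bound log u ≥
1 - 1/u at u = p/(cq) is summed with the free parameter c on A and with c = 1 off A. -/
theorem log_sum_event_bound {α : Type*} [Fintype α] [DecidableEq α] (p q : α → ℝ) (hp : ∀ a, 0 ≤ p a)
    (hq : ∀ a, 0 ≤ q a) (hpq : ∀ a, 0 < p a → 0 < q a) (hp1 : ∑ a, p a = 1) (hq1 : ∑ a, q a ≤ 1)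
    (A : Finset α) {c : ℝ} (hc : 0 < c) :
    (∑ a ∈ A, p a) * Real.log c - c * ∑ a ∈ A, q a ≤ ∑ a, p a * Real.log (p a / q a) := by
  have key : ∀ a (c : ℝ), 0 < c → p a - c * q a + p a * Real.log c ≤ p a * Real.log (p a / q a) := by
    intro a c hc
    rcases (hp a).eq_or_lt with h | h
    · rw [← h]; simpa using mul_nonneg hc.le (hq a)
    · have hqa := hpq a h
      have h1 := Real.one_sub_inv_le_log_of_pos (x := p a / (c * q a)) (by positivity)
      have h2 : Real.log (p a / (c * q a)) = Real.log (p a / q a) - Real.log c := by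
        rw [← Real.log_div (by positivity) hc.ne']
        congr 1; field_simp
      rw [h2, inv_div] at h1
      have h3 := mul_le_mul_of_nonneg_left h1 h.le
      have h4 : p a * (1 - c * q a / p a) = p a - c * q a := by field_simp
      linarith
  have hA : ∑ a ∈ A, (p a - c * q a + p a * Real.log c) ≤ ∑ a ∈ A, p a * Real.log (p a / q a) :=
    Finset.sum_le_sum fun a _ => key a c hc
  have hAc : ∑ a ∈ Aᶜ, (p a - q a) ≤ ∑ a ∈ Aᶜ, p a * Real.log (p a / q a) :=
    Finset.sum_le_sum fun a _ => by simpa using key a 1 one_pos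
  rw [← Finset.sum_add_sum_compl A] at hp1 hq1 ⊢
  simp only [Finset.sum_add_distrib, Finset.sum_sub_distrib, ← Finset.mul_sum,
    ← Finset.sum_mul] at hA hAc
  have : 0 ≤ ∑ a ∈ A, q a := Finset.sum_nonneg fun a _ => hq a
  linarith

theorem sum_measureReal_eq_one {Ω γ : Type*} [MeasurableSpace Ω] [Fintype γ] [MeasurableSpace γ]
    [MeasurableSingletonClass γ] (P : Measure Ω) [IsProbabilityMeasure P] {g : Ω → γ}
    (hg : Measurable g) : ∑ a, P.real {ω | g ω = a} = 1 := by
  have := sum_measureReal_preimage_singleton (μ := P) (Finset.univ : Finset γ) (f := g)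
    fun y _ => hg (measurableSet_singleton y)
  rw [Finset.coe_univ, Set.preimage_univ, probReal_univ] at this
  exact this

/-- Mutual information is the relative entropy of the joint law with respect to the product of its
marginals; the factor log 2 turns bits into nats. -/
theorem mutualInfo_event_bound {Ω α β : Type*} [MeasurableSpace Ω] [Fintype α] [Fintype β]
    [DecidableEq α] [DecidableEq β]
    [MeasurableSpace α] [MeasurableSpace β] [MeasurableSingletonClass α]
    [MeasurableSingletonClass β]
    (P : Measure Ω) [IsProbabilityMeasure P] {X : Ω → α} {Y : Ω → β} (hX : Measurable X)
    (hY : Measurable Y) (A : Finset (α × β)) {c : ℝ} (hc : 0 < c) :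
    P.real {ω | (X ω, Y ω) ∈ A} * Real.log c
        - c * ∑ v ∈ A, P.real {ω | X ω = v.1} * P.real {ω | Y ω = v.2}
      ≤ mutualInfo P X Y * Real.log 2 := by
  have hXY := hX.prodMk hY
  have hsum : ∀ B : Finset (α × β),
      ∑ v ∈ B, P.real {ω | X ω = v.1 ∧ Y ω = v.2} = P.real {ω | (X ω, Y ω) ∈ B} := by
    intro B
    rw [show {ω | (X ω, Y ω) ∈ B} = (fun ω => (X ω, Y ω)) ⁻¹' (B : Set (α × β)) from rfl,
      ← sum_measureReal_preimage_singleton B fun y _ => hXY (measurableSet_singleton y)]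
    refine Finset.sum_congr rfl fun v _ => ?_
    congr 1; ext ω; simp [Prod.ext_iff]
  have h := log_sum_event_bound (fun v : α × β => P.real {ω | X ω = v.1 ∧ Y ω = v.2})
    (fun v => P.real {ω | X ω = v.1} * P.real {ω | Y ω = v.2}) (fun _ => measureReal_nonneg)
    (fun _ => by positivity) ?_ ?_ ?_ A hc
  · rw [hsum A] at h
    refine h.trans_eq ?_
    rw [mutualInfo, Fintype.sum_prod_type, Finset.sum_mul]
    refine Finset.sum_congr rfl fun a _ => ?_
    rw [Finset.sum_mul]
    refine Finset.sum_congr rfl fun b _ => ?_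
    have : Real.log 2 ≠ 0 := (Real.log_pos one_lt_two).ne'
    rw [Real.logb]
    field_simp
  · intro v hv
    refine mul_pos (hv.trans_le (measureReal_mono ?_)) (hv.trans_le (measureReal_mono ?_))
    · exact fun ω h => h.1
    · exact fun ω h => h.2
  · rw [hsum]; simp
  · rw [Fintype.sum_prod_type]
    simp only [← Finset.mul_sum]
    rw [sum_measureReal_eq_one P hY, ← Finset.sum_mul, sum_measureReal_eq_one P hX]
    simp

/-! ### The law of the files -/

theorem filesLaw_isProbabilityMeasure (N F : ℕ) : IsProbabilityMeasure (filesLaw N F) := by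
  unfold filesLaw
  have : ∀ _ : Fin N, IsProbabilityMeasure
      (ProbabilityTheory.uniformOn (Set.univ : Set (Fin (2 ^ F)))) := fun _ =>
    ProbabilityTheory.isProbabilityMeasure_uniformOn Set.finite_univ Set.univ_nonempty
  infer_instance

attribute [instance] filesLaw_isProbabilityMeasure

theorem filesLaw_real_cylinder {N F : ℕ} {ι : Type*} [Fintype ι] (e : ι → Fin N)
    (he : Function.Injective e) (v : ι → Fin (2 ^ F)) :
    (filesLaw N F).real {w | ∀ p, w (e p) = v p} = ((2 : ℝ) ^ (F * Fintype.card ι))⁻¹ := by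
  classical
  have : ∀ _ : Fin N, IsProbabilityMeasure
      (ProbabilityTheory.uniformOn (Set.univ : Set (Fin (2 ^ F)))) := fun _ =>
    ProbabilityTheory.isProbabilityMeasure_uniformOn Set.finite_univ Set.univ_nonempty
  have hset : {w : Files N F | ∀ p, w (e p) = v p} =
      Set.pi Set.univ fun n => {x | ∀ p, e p = n → x = v p} := by
    ext w
    simp only [Set.mem_ofPred_eq, Set.mem_pi, Set.mem_univ, true_imp_iff]
    exact ⟨fun h n p hp => hp ▸ h p, fun h p => h _ p rfl⟩
  have h1 : ∀ n, (ProbabilityTheory.uniformOn (Set.univ : Set (Fin (2 ^ F)))).real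
      {x | ∀ p, e p = n → x = v p} =
      if n ∈ Finset.univ.image e then ((2 : ℝ) ^ F)⁻¹ else 1 := by
    intro n
    split_ifs with hn
    · obtain ⟨p, -, rfl⟩ := Finset.mem_image.1 hn
      have : {x | ∀ p', e p' = e p → x = v p'} = {v p} := by
        ext x
        simp only [Set.mem_ofPred_eq, Set.mem_singleton_iff]
        exact ⟨fun h => h p rfl, fun h p' hp' => by rw [he hp', h]⟩
      rw [this, measureReal_def, ProbabilityTheory.uniformOn_univ]
      simp
    · have : {x : Fin (2 ^ F) | ∀ p', e p' = n → x = v p'} = Set.univ := by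
        ext x
        simp only [Set.mem_ofPred_eq, Set.mem_univ, iff_true]
        intro p hp
        exact absurd (Finset.mem_image.2 ⟨p, Finset.mem_univ _, hp⟩) hn
      rw [this]; simp
  rw [hset, filesLaw, measureReal_def, Measure.pi_pi, ENNReal.toReal_prod]
  simp only [← measureReal_def, h1]
  rw [Finset.prod_ite]
  simp [Finset.card_image_of_injective _ he, pow_mul]


/-! ### The cut-set bound with a secure first transmission -/

namespace Scheme

variable {N K F : ℕ} {M R : ℝ} (S : Scheme N K F M R)

instance : IsProbabilityMeasure S.law := by unfold law; infer_instance

theorem measurable_X (d : Demand N K) : Measurable (S.X d) :=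
  measurable_from_prod_countable_right fun w => S.measurable_encode d w

theorem law_real_fst (s : Set (Files N F)) :
    S.law.real {ω | ω.1 ∈ s} = (filesLaw N F).real s := by
  have h := (measurePreserving_fst (μ := filesLaw N F) (ν := S.ν)).measure_preimage
    (s := s) (Set.toFinite s).measurableSet.nullMeasurableSet
  rw [measureReal_def, measureReal_def, ← h]
  rfl

/-- The event is that the first transmission, completed by some guess of the other m transmissions
and of the l caches, decodes to the true files. It is likely under the joint law, while under the
product law its probability is at most the number of guesses divided by the number of values of the
(m + 1)l files. -/
theorem event_bound {l m : ℕ} (hlK : l ≤ K) (e : Fin (m + 1) × Fin l → Fin N)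
    (he : Function.Injective e) (d : Fin (m + 1) → Demand N K)
    (hd : ∀ i j, d i (Fin.castLE hlK j) = e (i, j)) {ε c : ℝ}
    (herr : ∀ d k, S.errorProb d k ≤ ε) (hc : 1 ≤ c) :
    (1 - (m + 1) * l * ε) * Real.log c
        - c * ((⌊(2 : ℝ) ^ (R * F)⌋₊ ^ m * ⌊(2 : ℝ) ^ (M * F)⌋₊ ^ l : ℕ) *
          ((2 : ℝ) ^ (F * ((m + 1) * l)))⁻¹)
      ≤ S.leakage (d 0) * Real.log 2 := by
  classical
  let D : Fin (m + 1) → Fin l → Fin ⌊(2 : ℝ) ^ (R * F)⌋₊ → Fin ⌊(2 : ℝ) ^ (M * F)⌋₊ → Fin (2 ^ F) :=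
    fun i j x z => S.decode (d i) (Fin.castLE hlK j) x z
  let G : Fin ⌊(2 : ℝ) ^ (R * F)⌋₊ →
      (Fin m → Fin ⌊(2 : ℝ) ^ (R * F)⌋₊) × (Fin l → Fin ⌊(2 : ℝ) ^ (M * F)⌋₊) →
      Fin (m + 1) × Fin l → Fin (2 ^ F) :=
    fun a yz p => D p.1 p.2 (Fin.cons (α := fun _ => Fin ⌊(2 : ℝ) ^ (R * F)⌋₊) a yz.1 p.1) (yz.2 p.2)
  let A : Finset (Fin ⌊(2 : ℝ) ^ (R * F)⌋₊ × Files N F) :=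
    Finset.univ.filter fun v => ∃ yz, ∀ p, v.2 (e p) = G v.1 yz p
  have h := mutualInfo_event_bound S.law (S.measurable_X (d 0)) measurable_fst A
    (one_pos.trans_le hc)
  refine le_trans ?_ h
  have hP : 1 - (m + 1) * l * ε ≤ S.law.real {ω | (S.X (d 0) ω, ω.1) ∈ A} := by
    have hcover : (Set.univ : Set (Files N F × S.Θ)) ⊆ {ω | (S.X (d 0) ω, ω.1) ∈ A} ∪
        ⋃ p ∈ (Finset.univ : Finset (Fin (m + 1) × Fin l)),
          {ω | S.decode (d p.1) (Fin.castLE hlK p.2) (S.X (d p.1) ω) (S.Z (Fin.castLE hlK p.2) ω)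
            ≠ ω.1 (d p.1 (Fin.castLE hlK p.2))} := by
      intro ω _
      by_cases hω : ∀ p : Fin (m + 1) × Fin l,
          S.decode (d p.1) (Fin.castLE hlK p.2) (S.X (d p.1) ω) (S.Z (Fin.castLE hlK p.2) ω)
            = ω.1 (d p.1 (Fin.castLE hlK p.2))
      · left
        refine Finset.mem_filter.2 ⟨Finset.mem_univ _,
          (fun i => S.X (d i.succ) ω, fun j => S.Z (Fin.castLE hlK j) ω), fun p => ?_⟩
        obtain ⟨i, j⟩ := p
        have := hω (i, j)
        simp only [hd] at this
        refine this.symm.trans ?_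
        refine Fin.cases ?_ (fun i => ?_) i <;> simp [G, D]
      · right
        push Not at hω
        obtain ⟨p, hp⟩ := hω
        exact Set.mem_biUnion (Finset.mem_coe.2 (Finset.mem_univ p)) hp
    have h1 := (measureReal_mono (μ := S.law) hcover).trans (measureReal_union_le _ _)
    have h2 := (measureReal_biUnion_finset_le (μ := S.law)
      (Finset.univ : Finset (Fin (m + 1) × Fin l)) fun p =>
          {ω | S.decode (d p.1) (Fin.castLE hlK p.2) (S.X (d p.1) ω) (S.Z (Fin.castLE hlK p.2) ω)
            ≠ ω.1 (d p.1 (Fin.castLE hlK p.2))}).trans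
      (Finset.sum_le_sum fun p _ => herr (d p.1) (Fin.castLE hlK p.2))
    simp only [probReal_univ] at h1
    simp only [Finset.sum_const, Finset.card_univ, Fintype.card_prod, Fintype.card_fin,
      nsmul_eq_mul, Nat.cast_mul, Nat.cast_add, Nat.cast_one] at h2
    linarith
  have hQ : ∑ v ∈ A, S.law.real {ω | S.X (d 0) ω = v.1} * S.law.real {ω | ω.1 = v.2} ≤
      (⌊(2 : ℝ) ^ (R * F)⌋₊ ^ m * ⌊(2 : ℝ) ^ (M * F)⌋₊ ^ l : ℕ) *
          ((2 : ℝ) ^ (F * ((m + 1) * l)))⁻¹ := by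
    -- With the first transmission fixed, each guess determines all (m + 1)l distinct files, so a
    -- union bound over guesses applies.
    have hslice : ∀ a, ∑ w with (a, w) ∈ A, S.law.real {ω | ω.1 = w} ≤
        (⌊(2 : ℝ) ^ (R * F)⌋₊ ^ m * ⌊(2 : ℝ) ^ (M * F)⌋₊ ^ l : ℕ) *
          ((2 : ℝ) ^ (F * ((m + 1) * l)))⁻¹ := by
      intro a
      have h1 : ∑ w with (a, w) ∈ A, S.law.real {ω | ω.1 = w} =
          (filesLaw N F).real {w | (a, w) ∈ A} := by
        have := sum_measureReal_preimage_singleton (μ := S.law) (f := Prod.fst)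
          (Finset.univ.filter fun w => (a, w) ∈ A)
          fun y _ => measurable_fst (measurableSet_singleton y)
        rw [← S.law_real_fst]
        refine this.trans ?_
        congr 1; ext ω; simp
      have h2 : {w | (a, w) ∈ A} ⊆ ⋃ yz ∈ (Finset.univ : Finset
          ((Fin m → Fin ⌊(2 : ℝ) ^ (R * F)⌋₊) × (Fin l → Fin ⌊(2 : ℝ) ^ (M * F)⌋₊))),
          {w : Files N F | ∀ p, w (e p) = G a yz p} := by
        intro w hw
        obtain ⟨yz, hyz⟩ := (Finset.mem_filter.1 hw).2
        exact Set.mem_biUnion (Finset.mem_coe.2 (Finset.mem_univ yz)) hyz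
      rw [h1]
      refine (measureReal_mono h2 (measure_ne_top _ _)).trans ((measureReal_biUnion_finset_le _ _).trans ?_)
      simp only [filesLaw_real_cylinder e he]
      simp
    calc _ = ∑ a, S.law.real {ω | S.X (d 0) ω = a} *
          ∑ w with (a, w) ∈ A, S.law.real {ω | ω.1 = w} := by
          rw [← Finset.filter_univ_mem A, Finset.sum_filter, Fintype.sum_prod_type]
          simp only [Finset.filter_univ_mem, Finset.mul_sum, Finset.sum_filter, mul_ite, mul_zero]
      _ ≤ ∑ a, S.law.real {ω | S.X (d 0) ω = a} * _ :=
          Finset.sum_le_sum fun a _ => mul_le_mul_of_nonneg_left (hslice a) measureReal_nonneg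
      _ = _ := by rw [← Finset.sum_mul, sum_measureReal_eq_one _ (S.measurable_X (d 0)), one_mul]
  exact sub_le_sub (mul_le_mul_of_nonneg_right hP (Real.log_nonneg hc))
    (mul_le_mul_of_nonneg_left hQ (one_pos.le.trans hc))

end Scheme

theorem SecurelyAchievable.cutset_bound {N K : ℕ} {M R : ℝ} (hach : SecurelyAchievable N K M R)
    {l m : ℕ} (hl : 1 ≤ l) (hlK : l ≤ K) (hlm : (m + 1) * l ≤ N) :
    l * (m + 1 - M) ≤ m * R := by
  by_contra! hlt
  set δ : ℝ := l * (m + 1 - M) - m * R with hδ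
  have hδ0 : 0 < δ := sub_pos.2 hlt
  have hml : (1 : ℝ) ≤ (m + 1) * l := by
    have : 1 ≤ (m + 1) * l := Nat.mul_pos (Nat.succ_pos m) hl
    exact_mod_cast this
  -- This tolerance makes the total error over the (m + 1)l decodings at most 1/2.
  obtain ⟨F₀, hF₀⟩ := hach (1 / (2 * ((m + 1) * l))) (by positivity)
  have htend : Filter.Tendsto (fun F : ℕ => Real.exp 3 * ((2 : ℝ) ^ (-δ)) ^ F) Filter.atTop
      (nhds (Real.exp 3 * 0)) :=
    (tendsto_pow_atTop_nhds_zero_of_lt_one (by positivity)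
      (Real.rpow_lt_one_of_one_lt_of_neg one_lt_two (by linarith))).const_mul _
  rw [mul_zero] at htend
  obtain ⟨F, hFF₀, hF⟩ := ((Filter.eventually_ge_atTop F₀).and
    (htend.eventually_lt_const (one_half_pos (α := ℝ)))).exists
  obtain ⟨S, herr, hleak⟩ := hF₀ F hFF₀
  let e : Fin (m + 1) × Fin l → Fin N := fun p => Fin.castLE hlm (finProdFinEquiv p)
  have he : Function.Injective e := (Fin.castLE_injective hlm).comp finProdFinEquiv.injective
  have hN : 0 < N := (Nat.mul_pos (Nat.succ_pos m) hl).trans_le hlm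
  let d : Fin (m + 1) → Demand N K := fun i k =>
    if h : k.1 < l then e (i, ⟨k.1, h⟩) else ⟨0, hN⟩
  -- With c = e³ the left side exceeds 3/2 - 1/2 = 1 for this F, whereas the leakage in nats is at
  -- most 1/2.
  have h := S.event_bound hlK e he d (fun i j => by simp [d]) herr
    (c := Real.exp 3) (Real.one_le_exp (by norm_num))
  rw [Real.log_exp] at h
  have hcard : ((⌊(2 : ℝ) ^ (R * F)⌋₊ ^ m * ⌊(2 : ℝ) ^ (M * F)⌋₊ ^ l : ℕ) : ℝ) *
      ((2 : ℝ) ^ (F * ((m + 1) * l)))⁻¹ ≤ ((2 : ℝ) ^ (-δ)) ^ F := by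
    push_cast
    calc _ ≤ ((2 : ℝ) ^ (R * F)) ^ m * ((2 : ℝ) ^ (M * F)) ^ l *
          ((2 : ℝ) ^ (F * ((m + 1) * l)))⁻¹ := by
          gcongr <;> exact Nat.floor_le (by positivity)
      _ = _ := by
          rw [← Real.rpow_natCast, ← Real.rpow_natCast, ← Real.rpow_natCast, ← Real.rpow_natCast,
            ← Real.rpow_mul zero_le_two, ← Real.rpow_mul zero_le_two, ← Real.rpow_mul zero_le_two,
            ← Real.rpow_neg zero_le_two, ← Real.rpow_add two_pos, ← Real.rpow_add two_pos, hδ]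
          congr 1
          push_cast
          ring
  have h1 : (m + 1) * l * (1 / (2 * ((m + 1) * l))) = (1 / 2 : ℝ) := by field_simp
  have h2 : (1 / (2 * ((m + 1) * l)) : ℝ) ≤ 1 / 2 := by
    apply one_div_le_one_div_of_le <;> linarith
  have h3 : Real.log 2 < 1 := by linarith [Real.log_two_lt_d9]
  have h4 : 0 < Real.log 2 := Real.log_pos one_lt_two
  have h5 : S.leakage (d 0) * Real.log 2 ≤ 1 / 2 :=
    (mul_le_mul_of_nonneg_right ((hleak (d 0)).trans h2) h4.le).trans (by linarith)
  have h6 := mul_le_mul_of_nonneg_left hcard (Real.exp_pos 3).le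
  rw [h1] at h
  linarith

/-! ### One-time pad encryption -/

theorem uniformOn_real_singleton {S : Type*} [Fintype S] [MeasurableSpace S]
    [MeasurableSingletonClass S] (s : S) :
    (ProbabilityTheory.uniformOn (Set.univ : Set S)).real {s} = (Fintype.card S : ℝ)⁻¹ := by
  rw [measureReal_def, ProbabilityTheory.uniformOn_univ]
  simp

theorem mutualInfo_eq_zero {Ω α β : Type*} [MeasurableSpace Ω] [Fintype α] [Fintype β]
    {P : Measure Ω} {X : Ω → α} {Y : Ω → β}
    (h : ∀ a b, P.real {ω | X ω = a ∧ Y ω = b} = P.real {ω | X ω = a} * P.real {ω | Y ω = b}) :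
    mutualInfo P X Y = 0 := by
  refine Finset.sum_eq_zero fun a _ => Finset.sum_eq_zero fun b _ => ?_
  rw [h a b]
  by_cases h0 : P.real {ω | X ω = a} * P.real {ω | Y ω = b} = 0
  · rw [h0, zero_mul]
  · rw [div_self h0, Real.logb_one, mul_zero]

theorem measureReal_eq_sum_and_eq {Ω β : Type*} [MeasurableSpace Ω] [Fintype β]
    [MeasurableSpace β] [MeasurableSingletonClass β] (P : Measure Ω) [IsFiniteMeasure P]
    {Y : Ω → β} (hY : Measurable Y) (s : Set Ω) :
    P.real s = ∑ b, P.real {ω | ω ∈ s ∧ Y ω = b} := by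
  have := sum_measureReal_preimage_singleton (μ := P.restrict s) (Finset.univ : Finset β) (f := Y)
    (fun y _ => hY (measurableSet_singleton y)) fun _ _ => measure_ne_top _ _
  rw [Finset.coe_univ, Set.preimage_univ, measureReal_restrict_apply MeasurableSet.univ,
    Set.univ_inter] at this
  rw [← this]
  refine Finset.sum_congr rfl fun b _ => ?_
  rw [measureReal_restrict_apply (hY (measurableSet_singleton b))]
  congr 1; ext ω; exact and_comm

theorem Scheme.law_real_eq_sum_fst {N K F : ℕ} {M R : ℝ} (S : Scheme N K F M R)
    (s : Set (Files N F × S.Θ)) : S.law.real s = ∑ b, S.law.real {ω | ω ∈ s ∧ ω.1 = b} :=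
  measureReal_eq_sum_and_eq _ measurable_fst _

/-- A scheme that encrypts a message with a uniform one-time pad. -/
theorem exists_scheme_of_oneTimePad {N K F : ℕ} {M R : ℝ} {S : Type} [Fintype S] [AddCommGroup S]
    {C : Fin K → Type} [∀ k, Fintype (C k)]
    (hS : Fintype.card S ≤ ⌊(2 : ℝ) ^ (R * F)⌋₊) (hC : ∀ k, Fintype.card (C k) ≤ ⌊(2 : ℝ) ^ (M * F)⌋₊)
    (z : ∀ k, Files N F → S → C k) (g : Demand N K → Files N F → S)
    (dec : Demand N K → ∀ k, S → C k → Fin (2 ^ F))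
    (hdec : ∀ d k w s, dec d k (g d w + s) (z k w s) = w (d k)) :
    ∃ T : Scheme N K F M R, (∀ d k, T.errorProb d k = 0) ∧ ∀ d, T.leakage d = 0 := by
  classical
  obtain ⟨ι⟩ := Function.Embedding.nonempty_of_card_le
    (hS.trans_eq (Fintype.card_fin _).symm)
  have hκ := fun k => Function.Embedding.nonempty_of_card_le
    ((hC k).trans_eq (Fintype.card_fin _).symm)
  let κ := fun k => (hκ k).some
  have hne : ∀ k, Nonempty (C k) := fun k => ⟨z k (fun _ => 0) 0⟩
  let _ : MeasurableSpace S := ⊤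
  have _ : DiscreteMeasurableSpace S := ⟨fun _ => trivial⟩
  let T : Scheme N K F M R :=
    { Θ := S
      mΘ := ⊤
      ν := ProbabilityTheory.uniformOn Set.univ
      prob := ProbabilityTheory.isProbabilityMeasure_uniformOn Set.finite_univ Set.univ_nonempty
      cache := fun k w s => κ k (z k w s)
      measurable_cache := fun _ _ => measurable_from_top
      encode := fun d w s => ι (g d w + s)
      measurable_encode := fun _ _ => measurable_from_top
      decode := fun d k x y => dec d k (Function.invFun ι x) (Function.invFun (κ k) y) }
  refine ⟨T, fun d k => ?_, fun d => mutualInfo_eq_zero fun a b => ?_⟩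
  · have : {ω | T.decode d k (T.X d ω) (T.Z k ω) ≠ ω.1 (d k)} = ∅ := by
      refine Set.eq_empty_of_forall_notMem fun ω hω => hω ?_
      change dec d k (Function.invFun ι (ι (g d ω.1 + ω.2)))
        (Function.invFun (κ k) (κ k (z k ω.1 ω.2))) = _
      rw [Function.leftInverse_invFun ι.injective, Function.leftInverse_invFun (κ k).injective, hdec]
    rw [Scheme.errorProb, this, measureReal_empty]
  -- The probability q of the ciphertext a depends on neither the demand nor the files, which is the
  -- perfect secrecy of the pad.
  · let q : ℝ := if a ∈ Set.range ι then (Fintype.card S : ℝ)⁻¹ else 0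
    have hq : ∀ c : S, (ProbabilityTheory.uniformOn (Set.univ : Set S)).real
        {s | ι (c + s) = a} = q := by
      intro c
      by_cases ha : a ∈ Set.range ι
      · obtain ⟨s₀, rfl⟩ := ha
        have : {s | ι (c + s) = ι s₀} = {s₀ - c} := by
          ext s
          simp only [Set.mem_ofPred_eq, ι.injective.eq_iff, Set.mem_singleton_iff]
          rw [eq_sub_iff_add_eq, add_comm]
        rw [this, uniformOn_real_singleton]
        simp [q]
      · have : {s | ι (c + s) = a} = ∅ :=
          Set.eq_empty_of_forall_notMem fun s hs => ha ⟨_, hs⟩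
        rw [this]
        simp [q, if_neg ha]
    have hjoint : ∀ b, T.law.real {ω | T.X d ω = a ∧ ω.1 = b} = (filesLaw N F).real {b} * q := by
      intro b
      rw [← hq (g d b)]
      have : {ω : Files N F × T.Θ | T.X d ω = a ∧ ω.1 = b} = {b} ×ˢ {s : S | ι (g d b + s) = a} := by
        ext ⟨w, s⟩
        simp only [Set.mem_ofPred_eq, Set.mem_prod, Set.mem_singleton_iff]
        constructor
        · rintro ⟨h, rfl⟩; exact ⟨rfl, h⟩
        · rintro ⟨rfl, h⟩; exact ⟨h, rfl⟩
      rw [this]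
      exact measureReal_prod_prod _ _
    have hfst : ∀ b, T.law.real {ω | ω.1 = b} = (filesLaw N F).real {b} := fun b =>
      T.law_real_fst {b}
    have hX : T.law.real {ω | T.X d ω = a} = q := by
      have h1 : T.law.real {ω | T.X d ω = a} =
          ∑ b, T.law.real {ω | T.X d ω = a ∧ ω.1 = b} :=
        T.law_real_eq_sum_fst _
      rw [h1]
      simp only [hjoint, ← Finset.sum_mul]
      have := sum_measureReal_eq_one (filesLaw N F) (g := id) measurable_id
      simp only [id, Set.ofPred_eq_eq_singleton] at this
      rw [this, one_mul]
    rw [hjoint, hX, hfst, mul_comm]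

/-! ### Coded caching with keys -/

/-- Indices of bits: a level `t`, a position among the `b t` of this level, and a set of users. -/
abbrev BitIndex {K : ℕ} (b : Fin (K + 1) → ℕ) (P : Fin (K + 1) → Finset (Fin K) → Prop) : Type :=
  Σ t : Fin (K + 1), Fin (b t) × {T : Finset (Fin K) // P t T}

/-- What a user caches: the bits of all files and the key bits whose sets contain this user. -/
abbrev CacheContent {K : ℕ} (N : ℕ) (b : Fin (K + 1) → ℕ) (k : Fin K) : Type :=
  (Fin N × (BitIndex b fun t T => T.card = t ∧ k ∈ T) → ZMod 2) ×
    ((BitIndex b fun t T => T.card = t + 1 ∧ k ∈ T) → ZMod 2)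

instance {K : ℕ} (N : ℕ) (b : Fin (K + 1) → ℕ) (k : Fin K) : Fintype (CacheContent N b k) :=
  instFintypeProd _ _

/-- A bit with index set T is cached by the users in T. Each set U of size t + 1 receives the sum
over j ∈ U of the U \ {j} bit of the file wanted by j, masked by a key bit known to U. A user k ∉ T
takes U = T ∪ {k} and removes the key and the other summands, whose index sets all contain k. -/
theorem exists_scheme_of_card_le {N K F : ℕ} {M R : ℝ} (b : Fin (K + 1) → ℕ)
    (hF : F ≤ Fintype.card (BitIndex b fun t T => T.card = t))
    (hM : ∀ k, (N * Fintype.card (BitIndex b fun t T => T.card = t ∧ k ∈ T) +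
      Fintype.card (BitIndex b fun t T => T.card = t + 1 ∧ k ∈ T) : ℕ) ≤ M * F)
    (hR : (Fintype.card (BitIndex b fun t T => T.card = t + 1) : ℕ) ≤ R * F) :
    ∃ T : Scheme N K F M R, (∀ d k, T.errorProb d k = 0) ∧ ∀ d, T.leakage d = 0 := by
  have hfloor : ∀ {n : ℕ} {x : ℝ}, (n : ℝ) ≤ x → 2 ^ n ≤ ⌊(2 : ℝ) ^ x⌋₊ := by
    intro n x h
    refine Nat.le_floor ?_
    push_cast
    rw [← Real.rpow_natCast]
    exact Real.rpow_le_rpow_of_exponent_le one_le_two h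
  obtain ⟨φ⟩ : Nonempty (Fin (2 ^ F) ↪ (BitIndex b (fun t T => T.card = t) → ZMod 2)) := by
    refine Function.Embedding.nonempty_of_card_le ?_
    simpa only [Fintype.card_fin, Fintype.card_fun, ZMod.card] using
      Nat.pow_le_pow_right two_pos hF
  -- Extension by zero to all sets T spares the sums below the cardinality proofs.
  let f (x : Fin (2 ^ F)) (t : Fin (K + 1)) (p : Fin (b t)) (T : Finset (Fin K)) : ZMod 2 :=
    if h : T.card = t then φ x ⟨t, p, T, h⟩ else 0
  let z (k : Fin K) (w : Files N F) (s : (BitIndex b fun t T => T.card = t + 1) → ZMod 2) :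
      CacheContent N b k :=
    (fun q => φ (w q.1) ⟨q.2.1, q.2.2.1, q.2.2.2.1, q.2.2.2.2.1⟩,
      fun q => s ⟨q.1, q.2.1, q.2.2.1, q.2.2.2.1⟩)
  let fc (k : Fin K) (c : CacheContent N b k) (n : Fin N) (t : Fin (K + 1)) (p : Fin (b t))
      (T : Finset (Fin K)) : ZMod 2 :=
    if h : T.card = t ∧ k ∈ T then c.1 (n, ⟨t, p, T, h⟩) else 0
  have hfc : ∀ k w s n t p T, k ∈ T → fc k (z k w s) n t p T = f (w n) t p T := by
    intro k w s n t p T hk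
    by_cases h : T.card = t
    · simp [fc, f, z, h, hk]
    · simp [fc, f, h]
  let rec_bits (d : Demand N K) (k : Fin K) (x : (BitIndex b fun t T => T.card = t + 1) → ZMod 2)
      (c : CacheContent N b k) : (BitIndex b fun t T => T.card = t) → ZMod 2 := fun q =>
    if h : k ∈ q.2.2.1 then c.1 (d k, ⟨q.1, q.2.1, q.2.2.1, q.2.2.2, h⟩) else
      x ⟨q.1, q.2.1, insert k q.2.2.1, (Finset.card_insert_of_notMem h).trans (congrArg (· + 1) q.2.2.2)⟩
      - c.2 ⟨q.1, q.2.1, insert k q.2.2.1, (Finset.card_insert_of_notMem h).trans (congrArg (· + 1) q.2.2.2),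
          Finset.mem_insert_self _ _⟩
      - ∑ j ∈ q.2.2.1, fc k c (d j) q.1 q.2.1 ((insert k q.2.2.1).erase j)
  refine exists_scheme_of_oneTimePad (S := (BitIndex b fun t T => T.card = t + 1) → ZMod 2)
    (C := CacheContent N b) ?_ ?_ z
    (fun d w u => ∑ j ∈ u.2.2.1, f (w (d j)) u.1 u.2.1 (u.2.2.1.erase j))
    (fun d k x c => Function.invFun φ (rec_bits d k x c)) ?_
  · rw [Fintype.card_fun, ZMod.card]
    exact hfloor hR
  · intro k
    rw [Fintype.card_prod, Fintype.card_fun, Fintype.card_fun, ZMod.card, Fintype.card_prod,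
      Fintype.card_fin, ← pow_add]
    exact hfloor (hM k)
  · intro d k w s
    have : rec_bits d k ((fun u => ∑ j ∈ u.2.2.1, f (w (d j)) u.1 u.2.1 (u.2.2.1.erase j)) + s)
        (z k w s) = φ (w (d k)) := by
      funext ⟨t, p, T, hT⟩
      by_cases h : k ∈ T
      · simp [rec_bits, h, z]
      · have h1 : ∑ j ∈ T, fc k (z k w s) (d j) t p ((insert k T).erase j) =
            ∑ j ∈ T, f (w (d j)) t p ((insert k T).erase j) :=
          Finset.sum_congr rfl fun j hj => hfc _ _ _ _ _ _ _ (Finset.mem_erase.2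
            ⟨fun hkj => h (hkj ▸ hj), Finset.mem_insert_self _ _⟩)
        have h2 : f (w (d k)) t p T = φ (w (d k)) ⟨t, p, T, hT⟩ := by simp [f, hT]
        simp only [rec_bits, h, dif_neg, not_false_eq_true, Pi.add_apply]
        rw [h1, Finset.sum_insert h, Finset.erase_insert h, h2]
        simp only [z]
        ring
    change Function.invFun φ _ = _
    rw [this, Function.leftInverse_invFun φ.injective]

/-! ### Memory and rate of each level -/

theorem card_bitIndex {K : ℕ} (b : Fin (K + 1) → ℕ) (P : Fin (K + 1) → Finset (Fin K) → Prop)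
    [∀ t, DecidablePred (P t)] :
    Fintype.card (BitIndex b P) = ∑ t, b t * Fintype.card {T : Finset (Fin K) // P t T} := by
  simp

theorem card_subsets {K : ℕ} (t : ℕ) :
    Fintype.card {T : Finset (Fin K) // T.card = t} = K.choose t := by
  simp

theorem card_subsets_mem {K : ℕ} (t : ℕ) (k : Fin K) :
    (Fintype.card {T : Finset (Fin K) // T.card = t ∧ k ∈ T} : ℝ) = K.choose t * (t / K) := by
  obtain ⟨n, rfl⟩ : ∃ n, K = n + 1 := Nat.exists_eq_add_one.2 k.pos
  have h1 : Fintype.card {T : Finset (Fin (n + 1)) // T.card = t ∧ k ∈ T} + n.choose t =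
      (n + 1).choose t := by
    rw [← card_subsets (K := n + 1), Fintype.card_subtype, Fintype.card_subtype]
    have h2 : n.choose t = (Finset.univ.filter fun T : Finset (Fin (n + 1)) =>
        T.card = t ∧ ¬ k ∈ T).card := by
      have : (Finset.univ.filter fun T : Finset (Fin (n + 1)) => T.card = t ∧ ¬ k ∈ T) =
          Finset.powersetCard t (Finset.univ.erase k) := by
        ext T
        simp only [Finset.mem_filter, Finset.mem_univ, true_and, Finset.mem_powersetCard,
          Finset.subset_erase, Finset.subset_univ]
        tauto
      rw [this, Finset.card_powersetCard, Finset.card_erase_of_mem (Finset.mem_univ k)]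
      simp
    rw [h2, ← Finset.filter_filter, ← Finset.filter_filter, Finset.card_filter_add_card_filter_not]
  have h3 := Nat.choose_mul_succ_eq n t
  rcases le_or_gt t (n + 1) with ht | ht
  · have h4 : (n.choose t : ℝ) * (n + 1) = (n + 1).choose t * (n + 1 - t) := by
      rw [← Nat.cast_one, ← Nat.cast_add, ← Nat.cast_sub ht]
      exact_mod_cast h3
    have h5 : (Fintype.card {T : Finset (Fin (n + 1)) // T.card = t ∧ k ∈ T} : ℝ) + n.choose t =
      (n + 1).choose t := by exact_mod_cast h1
    push_cast
    field_simp
    linear_combination (n + 1 : ℝ) * h5 - h4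
  · rw [Nat.choose_eq_zero_of_lt ht] at h1 ⊢
    have : Fintype.card {T : Finset (Fin (n + 1)) // T.card = t ∧ k ∈ T} = 0 := by omega
    rw [this]; simp

/-- This value is the ratio of C(K, t+1) multicast bits to C(K, t) file bits. -/
theorem rateFormula_cornerMemory {N K t : ℕ} (hN : 2 ≤ N) (hK : 1 ≤ K) :
    rateFormula N K (cornerMemory N K t) = ((K : ℝ) - t) / (t + 1) := by
  have h1 : (0 : ℝ) < N - 1 := by
    have : (2 : ℝ) ≤ N := by exact_mod_cast hN
    linarith
  have h2 : (0 : ℝ) < K := by exact_mod_cast hK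
  have h3 : (cornerMemory N K t - 1) / ((N : ℝ) - 1) = t / K := by
    rw [cornerMemory]; field_simp; ring
  rw [rateFormula, h3]
  field_simp
  ring

/-- Level t carries b_t C(K, t) bits of each file. Per such bit a user stores Nt/K bits of content
and (K - t)/K bits of key, together the corner memory. -/
theorem exists_scheme_of_levels {N K F : ℕ} {M R : ℝ} (hN : 2 ≤ N) (hK : 1 ≤ K)
    (b : Fin (K + 1) → ℕ) (hF : (F : ℝ) ≤ ∑ t, (b t * K.choose t : ℝ))
    (hM : ∑ t, (b t * K.choose t : ℝ) * cornerMemory N K t ≤ M * F)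
    (hR : ∑ t, (b t * K.choose t : ℝ) * rateFormula N K (cornerMemory N K t) ≤ R * F) :
    ∃ T : Scheme N K F M R, (∀ d k, T.errorProb d k = 0) ∧ ∀ d, T.leakage d = 0 := by
  have hK0 : (K : ℝ) ≠ 0 := by exact_mod_cast (Nat.pos_of_ne_zero (by omega)).ne'
  have hchoose : ∀ t : Fin (K + 1),
      (K.choose (t + 1) : ℝ) * (t + 1) = K.choose t * (K - t) := by
    intro t
    rw [← Nat.cast_sub (Nat.lt_succ_iff.1 t.2)]
    exact_mod_cast Nat.choose_succ_right_eq K t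
  refine exists_scheme_of_card_le b ?_ (fun k => ?_) ?_
  · rw [card_bitIndex]
    simp only [card_subsets]
    exact_mod_cast hF
  · refine le_trans (le_of_eq ?_) hM
    rw [card_bitIndex, card_bitIndex]
    push_cast
    rw [Finset.mul_sum, ← Finset.sum_add_distrib]
    refine Finset.sum_congr rfl fun t _ => ?_
    rw [card_subsets_mem, card_subsets_mem, cornerMemory]
    push_cast
    field_simp
    linear_combination (b t : ℝ) * hchoose t
  · refine le_trans (le_of_eq ?_) hR
    rw [card_bitIndex]
    push_cast
    refine Finset.sum_congr rfl fun t _ => ?_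
    rw [card_subsets, rateFormula_cornerMemory hN hK]
    have : (t : ℝ) + 1 ≠ 0 := by positivity
    field_simp
    linear_combination (b t : ℝ) * hchoose t

/-! ### Time sharing between corner points -/

/-- A binomial coefficient equal to 1 leaves no rounding loss, so the exact pair is reached. This is
needed at M = 1, where memory has no slack. -/
theorem securelyAchievable_corner {N K : ℕ} (hN : 2 ≤ N) (hK : 1 ≤ K) (t : Fin (K + 1))
    (ht : K.choose t = 1) :
    SecurelyAchievable N K (cornerMemory N K t) (rateFormula N K (cornerMemory N K t)) := by
  intro ε hε
  refine ⟨0, fun F _ => ?_⟩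
  obtain ⟨T, h1, h2⟩ := exists_scheme_of_levels (F := F) (M := cornerMemory N K t)
    (R := rateFormula N K (cornerMemory N K t)) hN hK (fun s => if s = t then F else 0)
    (by simp [ht]) (by simp [ht, mul_comm]) (by simp [ht, mul_comm])
  exact ⟨T, fun d k => (h1 d k).trans_le hε.le, fun d => (h2 d).trans_le hε.le⟩

theorem securelyAchievable_of_weights {N K : ℕ} {M R : ℝ} (hN : 2 ≤ N) (hK : 1 ≤ K)
    (w : Fin (K + 1) → ℝ) (hw : w ∈ stdSimplex ℝ (Fin (K + 1)))
    (hM : ∑ t, w t * cornerMemory N K t < M)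
    (hR : ∑ t, w t * rateFormula N K (cornerMemory N K t) < R) :
    SecurelyAchievable N K M R := by
  -- Rounding up costs at most C(K, t) bits at level t, independently of F; the strict inequality
  -- absorbs this for large F.
  have hround : ∀ {r : Fin (K + 1) → ℝ} {c : ℝ}, (∀ t, 0 ≤ r t) → ∑ t, w t * r t < c →
      ∃ F₀ : ℕ, ∀ F : ℕ, F₀ ≤ F →
        ∑ t, (⌈w t * F / K.choose t⌉₊ * K.choose t : ℝ) * r t ≤ c * F := by
    intro r c hr hc
    obtain ⟨F₀, hF₀⟩ := exists_nat_ge ((∑ t : Fin (K + 1), K.choose t * r t) /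
      (c - ∑ t, w t * r t))
    refine ⟨F₀, fun F hF => ?_⟩
    have h1 : ∑ t : Fin (K + 1), K.choose t * r t ≤ F * (c - ∑ t, w t * r t) :=
      (div_le_iff₀ (sub_pos.2 hc)).1 (hF₀.trans (by exact_mod_cast hF))
    calc _ ≤ ∑ t : Fin (K + 1), (w t * F + K.choose t) * r t := by
          refine Finset.sum_le_sum fun t _ => mul_le_mul_of_nonneg_right ?_ (hr t)
          have hpos : (0 : ℝ) < K.choose t := by
            exact_mod_cast Nat.choose_pos (Nat.lt_succ_iff.1 t.2)
          have h2 := (Nat.ceil_lt_add_one (a := w t * F / K.choose t)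
            (div_nonneg (mul_nonneg (hw.1 t) F.cast_nonneg) hpos.le)).le
          calc _ ≤ (w t * F / K.choose t + 1) * K.choose t := by gcongr
            _ = _ := by field_simp
      _ = F * ∑ t, w t * r t + ∑ t : Fin (K + 1), K.choose t * r t := by
          rw [Finset.mul_sum, ← Finset.sum_add_distrib]
          exact Finset.sum_congr rfl fun t _ => by ring
      _ ≤ c * F := by linarith
  have hN1 : (0 : ℝ) ≤ N - 1 := by
    have : (2 : ℝ) ≤ N := by exact_mod_cast hN
    linarith
  obtain ⟨F₁, hF₁⟩ := hround (fun t => by unfold cornerMemory; positivity) hM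
  obtain ⟨F₂, hF₂⟩ := hround (fun t => by
    rw [rateFormula_cornerMemory hN hK]
    have : (t : ℝ) ≤ K := by exact_mod_cast Nat.lt_succ_iff.1 t.2
    exact div_nonneg (sub_nonneg.2 this) (by positivity)) hR
  intro ε hε
  refine ⟨max F₁ F₂, fun F hF => ?_⟩
  have hcover : (F : ℝ) ≤ ∑ t, (⌈w t * F / K.choose t⌉₊ * K.choose t : ℝ) :=
    calc (F : ℝ) = ∑ t, w t * F := by rw [← Finset.sum_mul, hw.2, one_mul]
      _ ≤ _ := Finset.sum_le_sum fun t _ => by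
          have hpos : (0 : ℝ) < K.choose t := by
            exact_mod_cast Nat.choose_pos (Nat.lt_succ_iff.1 t.2)
          exact (div_le_iff₀ hpos).1 (Nat.le_ceil _)
  obtain ⟨T, h1, h2⟩ := exists_scheme_of_levels (F := F) hN hK
    (fun t => ⌈w t * F / K.choose t⌉₊) hcover (hF₁ F ((le_max_left _ _).trans hF))
    (hF₂ F ((le_max_right _ _).trans hF))
  exact ⟨T, fun d k => (h1 d k).trans_le hε.le, fun d => (h2 d).trans_le hε.le⟩

theorem securelyAchievable_of_mem_convexHull {N K : ℕ} {M R M' R' : ℝ} (hN : 2 ≤ N) (hK : 1 ≤ K)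
    (h : (M', R') ∈ convexHull ℝ (cornerPoints N K)) (hM : M' < M) (hR : R' < R) :
    SecurelyAchievable N K M R := by
  have hsub : convexHull ℝ (cornerPoints N K) ⊆ Fintype.linearCombination ℝ
      (fun t : Fin (K + 1) => (cornerMemory N K t, rateFormula N K (cornerMemory N K t))) ''
        stdSimplex ℝ (Fin (K + 1)) := by
    refine convexHull_min ?_ ((convex_stdSimplex ℝ _).linear_image _)
    rintro _ ⟨t, rfl⟩
    exact ⟨Pi.single t 1, single_mem_stdSimplex ℝ t, by simp [Fintype.linearCombination_apply_single]⟩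
  obtain ⟨w, hw, hwe⟩ := hsub h
  rw [Fintype.linearCombination_apply, Prod.ext_iff, Prod.fst_sum, Prod.snd_sum] at hwe
  simp only [Prod.smul_mk, smul_eq_mul] at hwe
  exact securelyAchievable_of_weights hN hK w hw (hwe.1 ▸ hM) (hwe.2 ▸ hR)

/-! ### The lower convex envelope and the optimal rate -/

theorem cornerMemory_zero (N K : ℕ) : cornerMemory N K 0 = 1 := by simp [cornerMemory]

theorem cornerMemory_self {N K : ℕ} (hK : 1 ≤ K) : cornerMemory N K K = N := by
  have : (K : ℝ) ≠ 0 := by exact_mod_cast (Nat.pos_of_ne_zero (by omega)).ne'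
  rw [cornerMemory]; field_simp; ring

theorem one_mem_cornerPoints {N K : ℕ} (hN : 2 ≤ N) (hK : 1 ≤ K) :
    ((1 : ℝ), (K : ℝ)) ∈ cornerPoints N K :=
  ⟨0, Prod.ext (by simp [cornerMemory_zero])
    ((rateFormula_cornerMemory (t := 0) hN hK).trans (by simp))⟩

theorem full_mem_cornerPoints {N K : ℕ} (hN : 2 ≤ N) (hK : 1 ≤ K) :
    ((N : ℝ), (0 : ℝ)) ∈ cornerPoints N K :=
  ⟨Fin.last K, Prod.ext (by simp [cornerMemory_self hK])
    ((rateFormula_cornerMemory (t := K) hN hK).trans (by simp))⟩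

theorem nonneg_of_mem_convexHull {N K : ℕ} (hN : 2 ≤ N) (hK : 1 ≤ K) {v : ℝ × ℝ}
    (h : v ∈ convexHull ℝ (cornerPoints N K)) : 0 ≤ v.2 := by
  refine convexHull_min (t := {v : ℝ × ℝ | 0 ≤ v.2}) ?_
    (convex_halfSpace_ge (LinearMap.snd ℝ ℝ ℝ).isLinear 0) h
  rintro _ ⟨t, rfl⟩
  change 0 ≤ rateFormula _ _ _
  rw [rateFormula_cornerMemory hN hK]
  have : (t : ℝ) ≤ K := by exact_mod_cast Nat.lt_succ_iff.1 t.2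
  exact div_nonneg (sub_nonneg.2 this) (by positivity)

theorem le_of_one_mem_convexHull {N K : ℕ} (hN : 2 ≤ N) (hK : 1 ≤ K) {R : ℝ}
    (h : ((1 : ℝ), R) ∈ convexHull ℝ (cornerPoints N K)) : (K : ℝ) ≤ R := by
  have hN1 : (0 : ℝ) < N - 1 := by
    have : (2 : ℝ) ≤ N := by exact_mod_cast hN
    linarith
  have hK0 : (0 : ℝ) < K := by exact_mod_cast hK
  -- The line through (1, K) of slope -K²/(N - 1) lies below every corner: at corner t the claim is
  -- (K - t)/(t + 1) + Kt ≥ K, clear for t = 0 and for t ≥ 1.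
  have := convexHull_min
    (t := {v : ℝ × ℝ | K + K ^ 2 / ((N : ℝ) - 1) ≤ v.2 + K ^ 2 / ((N : ℝ) - 1) * v.1}) ?_
    (convex_halfSpace_ge
      (LinearMap.snd ℝ ℝ ℝ + (K ^ 2 / ((N : ℝ) - 1)) • LinearMap.fst ℝ ℝ ℝ).isLinear _) h
  · simpa using this
  · rintro _ ⟨t, rfl⟩
    change _ ≤ rateFormula _ _ _ + _ * cornerMemory _ _ _
    have h1 : (K : ℝ) ^ 2 / (N - 1) * cornerMemory N K t = K * t + K ^ 2 / (N - 1) := by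
      rw [cornerMemory]; field_simp
    have htK : (t : ℝ) ≤ K := by exact_mod_cast Nat.lt_succ_iff.1 t.2
    rw [h1, rateFormula_cornerMemory hN hK]
    have h2 : (K : ℝ) ≤ (K - t) / (t + 1) + K * t := by
      rcases Nat.eq_zero_or_pos (t : ℕ) with h0 | h0
      · simp [h0]
      · have h3 : (1 : ℝ) ≤ t := by exact_mod_cast h0
        have h4 : (0 : ℝ) ≤ (K - t) / (t + 1) := div_nonneg (sub_nonneg.2 htK) (by positivity)
        nlinarith
    linarith

theorem exists_achievable {N K : ℕ} {M : ℝ} (hN : 2 ≤ N) (hK : 1 ≤ K) (hM : 1 ≤ M) :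
    ∃ R, SecurelyAchievable N K M R := by
  rcases hM.eq_or_lt with rfl | h
  · exact ⟨_, by simpa [cornerMemory_zero] using securelyAchievable_corner hN hK 0 (by simp)⟩
  · exact ⟨_, securelyAchievable_of_mem_convexHull hN hK
      (subset_convexHull ℝ _ (one_mem_cornerPoints hN hK)) h (lt_add_one _)⟩

/-- The cut-set bound for one user and all the files. -/
theorem SecurelyAchievable.single_user_bound {N K : ℕ} {M R : ℝ} (hN : 2 ≤ N) (hK : 1 ≤ K)
    (h : SecurelyAchievable N K M R) : (N - M) / (N - 1) ≤ R := by
  obtain ⟨n, rfl⟩ : ∃ n, N = n + 1 := ⟨N - 1, by omega⟩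
  have hn : (0 : ℝ) < n := by exact_mod_cast (by omega : 0 < n)
  have := h.cutset_bound (l := 1) (m := n) le_rfl hK (by simp)
  push_cast at this ⊢
  rw [add_sub_cancel_right, div_le_iff₀ hn]
  linarith

theorem bddBelow_achievable {N K : ℕ} (M : ℝ) (hN : 2 ≤ N) (hK : 1 ≤ K) :
    BddBelow {R : ℝ | SecurelyAchievable N K M R} :=
  ⟨_, fun _ h => SecurelyAchievable.single_user_bound hN hK h⟩

theorem bddBelow_envelope {N K : ℕ} (M : ℝ) (hN : 2 ≤ N) (hK : 1 ≤ K) :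
    BddBelow {R : ℝ | (M, R) ∈ convexHull ℝ (cornerPoints N K)} :=
  ⟨0, fun _ h => nonneg_of_mem_convexHull hN hK h⟩

theorem optimalRate_le_of_mem_convexHull {N K : ℕ} {M R : ℝ} (hN : 2 ≤ N) (hK : 1 ≤ K)
    (hM : 1 ≤ M) (h : (M, R) ∈ convexHull ℝ (cornerPoints N K)) : optimalRate N K M ≤ R := by
  rcases hM.eq_or_lt with rfl | hM1
  · refine (csInf_le (bddBelow_achievable 1 hN hK) ?_).trans (le_of_one_mem_convexHull hN hK h)
    have := securelyAchievable_corner hN hK 0 (by simp)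
    rw [rateFormula_cornerMemory hN hK] at this
    simpa [cornerMemory_zero] using this
  · refine le_of_forall_pos_le_add fun δ hδ => csInf_le (bddBelow_achievable M hN hK) ?_
    have hK0 : (0 : ℝ) < K := by exact_mod_cast hK
    have hR := nonneg_of_mem_convexHull hN hK h
    -- Moving toward (1, K) with this weight strictly lowers the memory, as M > 1, and raises the
    -- rate by less than δ.
    have hη : 0 < δ / (K + δ) := by positivity
    have hη1 : δ / (K + δ) < 1 := by rw [div_lt_one (by positivity)]; linarith
    refine securelyAchievable_of_mem_convexHull hN hK
      ((convex_convexHull ℝ _) h (subset_convexHull ℝ _ (one_mem_cornerPoints hN hK))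
        (sub_nonneg.2 hη1.le) hη.le (sub_add_cancel 1 _)) ?_ ?_
    · change _ * M + _ * 1 < M
      nlinarith
    · change _ * R + _ * (K : ℝ) < R + δ
      have h1 : δ / (K + δ) * K < δ := by
        rw [div_mul_eq_mul_div, div_lt_iff₀ (by positivity)]; nlinarith
      have h2 : 0 ≤ δ / (K + δ) * R := mul_nonneg hη.le hR
      linarith

/-- The envelope lies below the chord from the corner point of level `t` to the last one. -/
theorem chord_mem_convexHull {N K t : ℕ} {x : ℝ} (hN : 2 ≤ N) (hK : 1 ≤ K) (htK : t < K)
    (htx : t ≤ K * x) (hx : x ≤ 1) :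
    (1 + x * (N - 1), (1 - x) * (K / (t + 1))) ∈ convexHull ℝ (cornerPoints N K) := by
  have hK0 : (0 : ℝ) < K := by exact_mod_cast hK
  have htK' : (0 : ℝ) < K - t := sub_pos.2 (by exact_mod_cast htK)
  have hcorner : (cornerMemory N K t, rateFormula N K (cornerMemory N K t)) ∈ cornerPoints N K :=
    ⟨⟨t, by omega⟩, rfl⟩
  -- Corner t has normalized memory t/K and rate (1 - t/K)K/(t + 1), so on the chord to (N, 0) the
  -- rate is (1 - x)K/(t + 1).
  have := (convex_convexHull ℝ _) (subset_convexHull ℝ _ hcorner)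
    (subset_convexHull ℝ _ (full_mem_cornerPoints hN hK))
    (a := K * (1 - x) / (K - t)) (b := (K * x - t) / (K - t))
    (div_nonneg (mul_nonneg hK0.le (sub_nonneg.2 hx)) htK'.le)
    (div_nonneg (sub_nonneg.2 htx) htK'.le) (by field_simp; ring)
  convert this using 1
  rw [rateFormula_cornerMemory hN hK, cornerMemory]
  have h1 : (t : ℝ) + 1 ≠ 0 := by positivity
  ext
  · simp only [Prod.smul_mk, Prod.mk_add_mk, smul_eq_mul]
    field_simp
    ring
  · simp only [Prod.smul_mk, Prod.mk_add_mk, smul_eq_mul]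
    field_simp
    ring

/-! ### The factor 17 -/

/-- The converse, in the normalized memory `x = (M - 1) / (N - 1)`. -/
theorem SecurelyAchievable.seventeenth_bound {N K : ℕ} {x B R : ℝ} (hN : 2 ≤ N) (hK : 1 ≤ K)
    (h : SecurelyAchievable N K (1 + x * (N - 1)) R) (hx0 : 0 ≤ x) (hx1 : x ≤ 1)
    (hBK : B ≤ K) (hBN : B ≤ 2 * N) (hxB : x * B ≤ 1) : (1 - x) * B / 17 ≤ R := by
  have hN1 : (0 : ℝ) < N - 1 := by
    have : (2 : ℝ) ≤ N := by exact_mod_cast hN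
    linarith
  rcases le_or_gt B 17 with hB | hB
  · have h1 := h.single_user_bound hN hK
    have h2 : (N - (1 + x * (N - 1))) / ((N : ℝ) - 1) = 1 - x := by field_simp; ring
    rw [h2] at h1
    nlinarith
  -- The cut-set bound reads R ≥ l(1 - x(N - 1)/m). Here l ≤ B/7 gives xl ≤ 1/7, and B ≤ 2N gives l
  -- ≤ 2N/7.
  · set l := ⌊B / 7⌋₊ with hl
    have hB7 : 0 ≤ B / 7 := by positivity
    have hlB : (l : ℝ) ≤ B / 7 := Nat.floor_le hB7
    have hl2 : 2 ≤ l := Nat.le_floor (by push_cast; linarith)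
    have hl2' : (2 : ℝ) ≤ l := by exact_mod_cast hl2
    have hBl : 2 * B ≤ 21 * l := by
      rcases le_or_gt B 21 with h21 | h21
      · linarith
      · have := Nat.lt_floor_add_one (B / 7)
        rw [← hl] at this
        linarith
    have hlK : l ≤ K := by exact_mod_cast (by linarith : (l : ℝ) ≤ K)
    have hlN : (l : ℝ) ≤ N := by linarith
    obtain ⟨m, hm⟩ : ∃ m, N / l = m + 1 := Nat.exists_eq_add_one.2
      (Nat.div_pos (by exact_mod_cast hlN) (by omega))
    have hlm : (m + 1) * l ≤ N := hm ▸ Nat.div_mul_le_self N l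
    have hml : (N : ℝ) + 1 ≤ (m + 2) * l := by
      have := Nat.lt_mul_div_succ N (by omega : 0 < l)
      rw [hm] at this
      have h3 : N + 1 ≤ (m + 2) * l := by
        rw [mul_comm]; exact this
      exact_mod_cast h3
    have hcut := h.cutset_bound (by omega : 1 ≤ l) hlK hlm
    have hxl : 7 * (x * l) ≤ 1 := by nlinarith
    -- With m + 1 = ⌊N/l⌋, ml ≥ N + 1 - 2l ≥ 3N/7 + 1, while 3x(N - 1)l ≤ 3(N - 1)/7.
    have hm3 : 3 * x * (N - 1) * l ≤ m * l := by nlinarith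
    have hm3' : 3 * x * (N - 1) ≤ m := le_of_mul_le_mul_right hm3 (by linarith)
    have hm0 : (0 : ℝ) < m := by
      have : (0 : ℝ) < m * l := by nlinarith
      exact pos_of_mul_pos_left this (by linarith)
    have h4 : (m : ℝ) * (2 * l / 3) ≤ m * R := by nlinarith
    have h5 : 2 * (l : ℝ) / 3 ≤ R := le_of_mul_le_mul_left h4 hm0
    -- Since l ≥ 2B/21, R ≥ 2l/3 ≥ 4B/63 ≥ B/17.
    nlinarith

end SecureCaching

theorem theorem3 (N K : ℕ) (hN : 2 ≤ N) (hK : 1 ≤ K) (M : ℝ)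
    (hM : max (((K : ℝ) - N) * ((N : ℝ) - 1) / ((K : ℝ) * N) + 1) 1 ≤ M) (hMN : M ≤ N) :
    (∃ R : ℝ, SecureCaching.SecurelyAchievable N K M R) ∧
    (M < N →
      0 < SecureCaching.optimalRate N K M ∧
      1 ≤ SecureCaching.centralizedRate N K M / SecureCaching.optimalRate N K M ∧
      SecureCaching.centralizedRate N K M / SecureCaching.optimalRate N K M ≤ 17) ∧
    (M = N →
      SecureCaching.centralizedRate N K M = 0 ∧ SecureCaching.optimalRate N K M = 0) := by
  open SecureCaching in
  have hM1 : 1 ≤ M := (le_max_right _ _).trans hM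
  have hMc := (le_max_left _ _).trans hM
  have hNpos : (0 : ℝ) < N := by exact_mod_cast (by omega : 0 < N)
  have hN1 : (0 : ℝ) < N - 1 := by
    have : (2 : ℝ) ≤ N := by exact_mod_cast hN
    linarith
  have hK0 : (0 : ℝ) < K := by exact_mod_cast hK
  have hne : {R : ℝ | SecurelyAchievable N K M R}.Nonempty := exists_achievable hN hK hM1
  have hsingle : (N - M) / (N - 1) ≤ optimalRate N K M :=
    le_csInf hne fun R hR => SecurelyAchievable.single_user_bound hN hK hR
  refine ⟨hne, fun hlt => ?_, ?_⟩
  · obtain ⟨x, rfl⟩ : ∃ x, M = 1 + x * (N - 1) := ⟨(M - 1) / (N - 1), by field_simp; ring⟩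
    have hx0 : 0 ≤ x := by
      by_contra! hneg
      nlinarith
    have hx1 : x < 1 := by
      by_contra! hge
      nlinarith
    have hxc : (K - N) / N ≤ K * x := by
      have h1 : ((K : ℝ) - N) * (N - 1) / (K * N) = (K - N) / N / K * (N - 1) := by field_simp
      have h2 : ((K : ℝ) - N) / N / K ≤ x := le_of_mul_le_mul_right (by linarith) hN1
      rw [div_le_iff₀ hK0] at h2
      linarith
    set t := ⌊K * x⌋₊ with ht
    have htx : (t : ℝ) ≤ K * x := Nat.floor_le (by positivity)
    have hxt : K * x < t + 1 := Nat.lt_floor_add_one _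
    have htK : t < K := by
      have : (t : ℝ) < K := by nlinarith
      exact_mod_cast this
    have ht1 : (0 : ℝ) < t + 1 := by positivity
    have hBK : (K : ℝ) / (t + 1) ≤ K := div_le_self hK0.le (by linarith [t.cast_nonneg (α := ℝ)])
    -- If K > 2N, then t + 1 > Kx ≥ K/N - 1 ≥ K/(2N) by the lower bound on M.
    have hBN : (K : ℝ) / (t + 1) ≤ 2 * N := by
      rcases le_or_gt (K : ℝ) (2 * N) with h | h
      · exact hBK.trans h
      · rw [div_le_iff₀ ht1]
        rw [div_le_iff₀ hNpos] at hxc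
        nlinarith
    have hxB : x * (K / (t + 1)) ≤ 1 := by
      rw [mul_div_assoc', div_le_one ht1]
      linarith
    have hchord := chord_mem_convexHull hN hK htK htx hx1.le
    have hup : centralizedRate N K (1 + x * (N - 1)) ≤ (1 - x) * (K / (t + 1)) :=
      csInf_le (bddBelow_envelope _ hN hK) hchord
    have hlow : (1 - x) * (K / (t + 1)) / 17 ≤ optimalRate N K (1 + x * (N - 1)) :=
      le_csInf hne fun R hR =>
        SecurelyAchievable.seventeenth_bound hN hK hR hx0 hx1.le hBK hBN hxB
    have hpos : 0 < optimalRate N K (1 + x * (N - 1)) :=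
      (div_pos (sub_pos.2 hlt) hN1).trans_le hsingle
    refine ⟨hpos, ?_, ?_⟩
    · rw [one_le_div hpos]
      exact le_csInf ⟨_, hchord⟩ fun R hR => optimalRate_le_of_mem_convexHull hN hK hM1 hR
    · rw [div_le_iff₀ hpos]
      linarith
  · rintro rfl
    have hmem := subset_convexHull ℝ _ (full_mem_cornerPoints hN hK)
    refine ⟨le_antisymm (csInf_le (bddBelow_envelope _ hN hK) hmem)
      (le_csInf ⟨_, hmem⟩ fun R hR => nonneg_of_mem_convexHull hN hK hR),
      le_antisymm (optimalRate_le_of_mem_convexHull hN hK hM1 hmem) ?_⟩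
    simpa using hsingle
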